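/- Let $\mathcal{B}$ be a complete Boolean algebra with Stone space $Q$, let $C(Q)$ be the algebra of continuous functions $Q\to\mathbb{R}$, and let $L^0(\mathcal{B})=C_\infty(Q)$ be the algebra and vector lattice of all continuous functions $x\colon Q\to[-\infty,+\infty]$ that take the values $\pm\infty$ at most on a nowhere dense set; the order is pointwise, and the sum, product and real multiples are the unique elements of $C_\infty(Q)$ that agree with the pointwise ones wherever the functions involved are finite. Identify $e\in\mathcal{B}$ with the characteristic function of the corresponding clopen subset of $Q$, and for $x\in L^0(\mathcal{B})$ let $s(x)=\mathbf{1}-\sup\{e\in\mathcal{B}: ex=0\}$ be its support. A solid space in $L^0(\mathcal{B})$ is a non-zero linear subspace $Y$ such that $x\in Y$, $y\in L^0(\mathcal{B})$, $|y|\le|x|$ imply $y\in Y$. A monotone quasi-norm on $Y$ is a map $\|\cdot\|_Y\colon Y\to[0,\infty)$ with $\|x\|_Y=0$ if and only if $x=0$, with $\|\alpha x\|_Y=|\alpha|\,\|x\|_Y$ for $\alpha\in\mathbb{R}$, with $\|x+y\|_Y\le C(\|x\|_Y+\|y\|_Y)$ for some constant $C\ge 1$ and all $x,y\in Y$, and with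 $\|y\|_Y\le\|x\|_Y$ whenever $|y|\le|x|$. **Theorem.** Let $X$ be an ideal in $C(Q)$ and let $Y$ be a solid space in $L^0(\mathcal{B})$ that carries a monotone quasi-norm. Let $\delta\colon X\to Y$ be a band preserving derivation, that is, a real-linear map with $\delta(xy)=\delta(x)y+x\delta(y)$ for all $x,y\in X$ and $s(\delta(x))\le s(x)$ for all $x\in X$. Then $\delta=0$. -/

import Mathlib

open Set Filter Topology

noncomputable section

universe u

/-! ### The Stone space of a Boolean algebra -/

/-- The Stone space of a Boolean algebra `B`: its points are the two-valued homomorphisms on `B`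
(equivalently, the ultrafilters of `B`), with the topology of pointwise convergence. -/
def StoneSpace (B : Type u) [BooleanAlgebra B] : Type u := BoundedLatticeHom B Bool

namespace StoneSpace

variable {B : Type u} [BooleanAlgebra B]

/-- The value of the two-valued homomorphism `t` at `b`. -/
def val (t : StoneSpace B) (b : B) : Bool := BoundedLatticeHom.toLatticeHom t b

instance : TopologicalSpace (StoneSpace B) := TopologicalSpace.induced val inferInstance

theorem val_injective : Function.Injective (val (B := B)) := by
  intro s t h
  exact DFunLike.coe_injective (F := BoundedLatticeHom B Bool) h

theorem continuous_val : Continuous (val (B := B)) := continuous_induced_dom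

@[simp] theorem val_top (t : StoneSpace B) : t.val ⊤ = true := map_top (F := BoundedLatticeHom B Bool) t
@[simp] theorem val_bot (t : StoneSpace B) : t.val ⊥ = false := map_bot (F := BoundedLatticeHom B Bool) t
@[simp] theorem val_inf (t : StoneSpace B) (a b : B) : t.val (a ⊓ b) = (t.val a && t.val b) :=
  map_inf (F := BoundedLatticeHom B Bool) t a b
@[simp] theorem val_sup (t : StoneSpace B) (a b : B) : t.val (a ⊔ b) = (t.val a || t.val b) :=
  map_sup (F := BoundedLatticeHom B Bool) t a b

theorem val_mono (t : StoneSpace B) {a b : B} (h : a ≤ b) (ha : t.val a = true) :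
    t.val b = true := by
  have := t.val_sup a b
  rw [sup_eq_right.2 h, ha] at this
  simpa using this

@[simp] theorem val_compl (t : StoneSpace B) (a : B) : t.val aᶜ = !t.val a := by
  have h1 := t.val_inf a aᶜ
  have h2 := t.val_sup a aᶜ
  rw [inf_compl_eq_bot, val_bot] at h1
  rw [sup_compl_eq_top, val_top] at h2
  revert h1 h2
  cases t.val a <;> cases t.val aᶜ <;> simp

instance : T2Space (StoneSpace B) := T2Space.of_injective_continuous val_injective continuous_val

theorem range_val : range (val (B := B)) = {f : B → Bool | f ⊤ = true ∧ f ⊥ = false ∧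
    ∀ a b, f (a ⊓ b) = (f a && f b) ∧ f (a ⊔ b) = (f a || f b)} := by
  ext f
  constructor
  · rintro ⟨t, rfl⟩
    exact ⟨t.val_top, t.val_bot, fun a b => ⟨t.val_inf a b, t.val_sup a b⟩⟩
  · rintro ⟨h1, h2, h3⟩
    refine ⟨(⟨⟨⟨f, fun a b => (h3 a b).2⟩, fun a b => (h3 a b).1⟩, h1, h2⟩ :
      BoundedLatticeHom B Bool), rfl⟩

theorem isClosed_range_val : IsClosed (range (val (B := B))) := by
  have hev : ∀ a : B, Continuous fun f : B → Bool => f a := fun a => continuous_apply a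
  have hand : ∀ a b : B, Continuous fun f : B → Bool => (f a && f b) := fun a b =>
    (continuous_of_discreteTopology (f := fun p : Bool × Bool => (p.1 && p.2))).comp
      ((hev a).prodMk (hev b))
  have hor : ∀ a b : B, Continuous fun f : B → Bool => (f a || f b) := fun a b =>
    (continuous_of_discreteTopology (f := fun p : Bool × Bool => (p.1 || p.2))).comp
      ((hev a).prodMk (hev b))
  rw [range_val]
  simp only [ofPred_and, ofPred_forall]
  exact (isClosed_eq (hev _) continuous_const).inter ((isClosed_eq (hev _) continuous_const).inter
    (isClosed_iInter fun a => isClosed_iInter fun b =>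
      (isClosed_eq (hev _) (hand a b)).inter (isClosed_eq (hev _) (hor a b))))

instance : CompactSpace (StoneSpace B) :=
  (IsClosedEmbedding.mk ⟨⟨rfl⟩, val_injective⟩ isClosed_range_val).compactSpace

/-- The clopen subset `Q(e)` of the Stone space corresponding to `e`. -/
def basic (e : B) : Set (StoneSpace B) := {t | t.val e = true}

@[simp] theorem mem_basic {e : B} {t : StoneSpace B} : t ∈ basic e ↔ t.val e = true := Iff.rfl

theorem isClopen_basic (e : B) : IsClopen (basic e) :=
  (isClopen_discrete {true}).preimage ((continuous_apply e).comp continuous_val)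

theorem exists_basic_subset {t : StoneSpace B} {U : Set (StoneSpace B)} (hU : IsOpen U)
    (ht : t ∈ U) : ∃ e : B, t ∈ basic e ∧ basic e ⊆ U := by
  obtain ⟨V, hV, rfl⟩ := isOpen_induced_iff.1 hU
  obtain ⟨I, u, hu, hsub⟩ := isOpen_pi_iff.1 hV t.val ht
  let c : B → B := fun b => if t.val b = true then b else bᶜ
  have hc : ∀ b, t.val (c b) = true := by
    intro b
    by_cases h : t.val b = true <;> simp [c, h]
  have hinf : ∀ (s : StoneSpace B) (J : Finset B),
      s.val (J.inf c) = true ↔ ∀ b ∈ J, s.val (c b) = true := by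
    intro s J
    classical
    induction J using Finset.induction_on with
    | empty => simp
    | insert a J ha ih => simp [Finset.inf_insert, ih]
  refine ⟨I.inf c, (hinf t I).2 fun b _ => hc b, fun s hs => hsub ?_⟩
  intro b hb
  have h := (hinf s I).1 hs b hb
  have : s.val b = t.val b := by
    by_cases hb' : t.val b = true
    · simpa [c, hb'] using h
    · simpa [c, hb'] using h
  rw [this]
  exact (hu b hb).2

theorem exists_mem_basic {e : B} (he : e ≠ ⊥) : ∃ t : StoneSpace B, t ∈ basic e := by
  obtain ⟨J, hJ, -, hd⟩ := DistribLattice.prime_ideal_of_disjoint_filter_ideal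
    (F := Order.PFilter.principal e) (I := Order.Ideal.principal (⊥ : B)) (by
      rw [Set.disjoint_left]
      intro x hx hx'
      have h1 : e ≤ x := hx
      have h2 : x ≤ ⊥ := hx'
      exact he (le_bot_iff.1 (h1.trans h2)))
  classical
  have heJ : e ∉ J := fun h => Set.disjoint_left.1 hd (show e ≤ e from le_rfl) h
  have htop : (⊤ : B) ∉ J := fun h => heJ (J.lower le_top h)
  have hinf : ∀ a b : B, a ⊓ b ∈ J ↔ a ∈ J ∨ b ∈ J := fun a b =>
    ⟨fun h => hJ.mem_or_mem h, fun h => h.elim (fun h => J.lower inf_le_left h)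
      (fun h => J.lower inf_le_right h)⟩
  have hmem : (fun b : B => decide (b ∉ J)) ∈ range (val (B := B)) := by
    rw [range_val]
    refine ⟨by simpa using htop, by simp, fun a b => ⟨?_, ?_⟩⟩
    · by_cases ha : a ∈ J <;> by_cases hb : b ∈ J <;> simp [hinf, ha, hb]
    · by_cases ha : a ∈ J <;> by_cases hb : b ∈ J <;> simp [Order.Ideal.sup_mem_iff, ha, hb]
  obtain ⟨t, ht⟩ := hmem
  exact ⟨t, by simp [ht, heJ]⟩

instance {B : Type u} [CompleteBooleanAlgebra B] : ExtremallyDisconnected (StoneSpace B) where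
  open_closure U hU := by
    let e : B := sSup {b | basic b ⊆ U}
    suffices h : closure U = basic e by rw [h]; exact (isClopen_basic e).isOpen
    apply Subset.antisymm
    · refine closure_minimal (fun t ht => ?_) (isClopen_basic e).isClosed
      obtain ⟨b, hb, hbU⟩ := exists_basic_subset hU ht
      exact t.val_mono (le_sSup (show b ∈ {b | basic b ⊆ U} from hbU)) hb
    · intro t ht
      rw [mem_closure_iff]
      intro V hV htV
      obtain ⟨c, hc, hcV⟩ := exists_basic_subset hV htV
      by_contra hne
      have hce : c ⊓ e = ⊥ := by
        rw [inf_sSup_eq]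
        refine iSup₂_eq_bot.2 fun b hb => ?_
        by_contra h
        obtain ⟨s, hs⟩ := exists_mem_basic h
        simp only [mem_basic, val_inf, Bool.and_eq_true] at hs
        exact hne ⟨s, hcV hs.1, hb hs.2⟩
      have := t.val_inf c e
      rw [hce, val_bot] at this
      simp only [mem_basic] at hc ht
      simp [hc, ht] at this

end StoneSpace

/-! ### The algebra `C_∞(Q)` of extended continuous functions -/

/-- `C_∞(Q)`: the continuous functions `Q → [-∞, +∞]` that take the values `±∞` at most on a
nowhere dense set. -/
structure CInfty (Q : Type u) [TopologicalSpace Q] : Type u where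
  /-- the underlying function -/
  toFun : Q → EReal
  continuous_toFun : Continuous toFun
  isNowhereDense_infinite : IsNowhereDense {t | toFun t = ⊥ ∨ toFun t = ⊤}

namespace CInfty

section Basic

variable {Q : Type u} [TopologicalSpace Q]

instance : CoeFun (CInfty Q) (fun _ => Q → EReal) := ⟨toFun⟩

@[ext] theorem ext {x y : CInfty Q} (h : ∀ t, x t = y t) : x = y := by
  cases x; cases y; congr; exact funext h

/-- The set of points at which `x` is finite. -/
def finSet (x : CInfty Q) : Set Q := {t | x t ≠ ⊥ ∧ x t ≠ ⊤}

theorem compl_finSet (x : CInfty Q) : x.finSetᶜ = {t | x t = ⊥ ∨ x t = ⊤} := by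
  ext t; simp only [finSet, mem_compl_iff, mem_ofPred_eq]; tauto

theorem isOpen_finSet (x : CInfty Q) : IsOpen x.finSet :=
  (isOpen_ne_fun x.continuous_toFun continuous_const).inter
    (isOpen_ne_fun x.continuous_toFun continuous_const)

theorem dense_finSet (x : CInfty Q) : Dense x.finSet := by
  have h := x.isNowhereDense_infinite
  rw [← compl_finSet, x.isOpen_finSet.isClosed_compl.isNowhereDense_iff,
    interior_eq_empty_iff_dense_compl, compl_compl] at h
  exact h

theorem isNowhereDense_of_dense {f : Q → EReal} (hf : Continuous f)
    (h : Dense {t | f t ≠ ⊥ ∧ f t ≠ ⊤}) : IsNowhereDense {t | f t = ⊥ ∨ f t = ⊤} := by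
  have hc : IsClosed {t | f t = ⊥ ∨ f t = ⊤} :=
    (isClosed_eq hf continuous_const).union (isClosed_eq hf continuous_const)
  rw [hc.isNowhereDense_iff, interior_eq_empty_iff_dense_compl]
  convert h using 1
  ext t; simp

theorem coe_toReal {x : CInfty Q} {t : Q} (ht : t ∈ x.finSet) : ((x t).toReal : EReal) = x t :=
  EReal.coe_toReal ht.2 ht.1

theorem continuousOn_toReal (x : CInfty Q) : ContinuousOn (fun t => (x t).toReal) x.finSet :=
  EReal.continuousOn_toReal.comp x.continuous_toFun.continuousOn fun t ht => by
    simpa [finSet] using ht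

/-- Every (finite) continuous real function is an element of `C_∞(Q)`. -/
def ofReal (f : C(Q, ℝ)) : CInfty Q where
  toFun t := (f t : EReal)
  continuous_toFun := continuous_coe_real_ereal.comp f.continuous
  isNowhereDense_infinite := by simp

@[simp] theorem ofReal_apply (f : C(Q, ℝ)) (t : Q) : ofReal f t = (f t : EReal) := rfl

instance : Zero (CInfty Q) := ⟨ofReal 0⟩

instance : One (CInfty Q) := ⟨ofReal 1⟩

/-- Negation is pointwise. -/
instance : Neg (CInfty Q) where
  neg x :=
    { toFun := fun t => -x t
      continuous_toFun := continuous_neg.comp x.continuous_toFun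
      isNowhereDense_infinite := by
        have h : {t | -x t = ⊥ ∨ -x t = ⊤} = {t | x t = ⊥ ∨ x t = ⊤} := by
          ext t; simp only [mem_ofPred_eq, EReal.neg_eq_bot_iff, EReal.neg_eq_top_iff]; tauto
        rw [h]
        exact x.isNowhereDense_infinite }

/-- The order is pointwise. -/
instance : PartialOrder (CInfty Q) where
  le x y := ∀ t, x t ≤ y t
  le_refl x t := le_rfl
  le_trans x y z h h' t := (h t).trans (h' t)
  le_antisymm x y h h' := ext fun t => le_antisymm (h t) (h' t)

/-- Suprema and infima of two elements are pointwise. -/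
instance : Lattice (CInfty Q) where
  sup x y :=
    { toFun := fun t => x t ⊔ y t
      continuous_toFun := x.continuous_toFun.sup y.continuous_toFun
      isNowhereDense_infinite := isNowhereDense_of_dense
        (x.continuous_toFun.sup y.continuous_toFun)
        ((x.dense_finSet.inter_of_isOpen_left y.dense_finSet x.isOpen_finSet).mono
          fun t ht => by
            rcases le_total (x t) (y t) with h | h
            · rw [mem_ofPred_eq, sup_eq_right.2 h]; exact ht.2
            · rw [mem_ofPred_eq, sup_eq_left.2 h]; exact ht.1) }
  inf x y :=
    { toFun := fun t => x t ⊓ y t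
      continuous_toFun := x.continuous_toFun.inf y.continuous_toFun
      isNowhereDense_infinite := isNowhereDense_of_dense
        (x.continuous_toFun.inf y.continuous_toFun)
        ((x.dense_finSet.inter_of_isOpen_left y.dense_finSet x.isOpen_finSet).mono
          fun t ht => by
            rcases le_total (x t) (y t) with h | h
            · rw [mem_ofPred_eq, inf_eq_left.2 h]; exact ht.1
            · rw [mem_ofPred_eq, inf_eq_right.2 h]; exact ht.2) }
  le_sup_left x y t := le_sup_left
  le_sup_right x y t := le_sup_right
  sup_le x y z h h' t := sup_le (h t) (h' t)
  inf_le_left x y t := inf_le_left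
  inf_le_right x y t := inf_le_right
  le_inf x y z h h' t := le_inf (h t) (h' t)

theorem neg_apply (x : CInfty Q) (t : Q) : (-x) t = -x t := rfl

/-- The germ of an element of `C_∞(Q)`, as a real function defined up to a meagre set. -/
def toGerm (x : CInfty Q) : (residual Q).Germ ℝ := ((fun t => (x t).toReal : Q → ℝ) : Germ _ ℝ)

theorem eventually_finSet (x : CInfty Q) : ∀ᶠ t in residual Q, t ∈ x.finSet :=
  residual_of_dense_open x.isOpen_finSet x.dense_finSet

theorem toGerm_neg (x : CInfty Q) : toGerm (-x) = -toGerm x :=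
  Germ.coe_eq.2 <| by
    filter_upwards with t
    simp [neg_apply]

theorem toGerm_ofReal (f : C(Q, ℝ)) : toGerm (ofReal f) = ((f : Q → ℝ) : Germ _ ℝ) := rfl

theorem toGerm_zero : toGerm (0 : CInfty Q) = 0 := rfl

theorem toGerm_one : toGerm (1 : CInfty Q) = 1 := rfl

end Basic

variable {Q : Type u} [TopologicalSpace Q] [CompactSpace Q] [T2Space Q] [ExtremallyDisconnected Q]

/-- A continuous extended-real function on a dense open subset of an extremally disconnected
compact space extends continuously to the whole space. -/
theorem exists_continuous_extension {U : Set Q} (hU : IsOpen U) (hd : Dense U) {g : Q → EReal}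
    (hg : ContinuousOn g U) : ∃ f : Q → EReal, Continuous f ∧ ∀ t ∈ U, f t = g t := by
  let G : Set (Q × EReal) := (fun t => (t, g t)) '' U
  let K : Set (Q × EReal) := closure G
  have hKc : IsCompact K := isClosed_closure.isCompact
  have : CompactSpace K := isCompact_iff_compactSpace.1 hKc
  have hπ : Continuous fun p : K => p.1.1 := continuous_fst.comp continuous_subtype_val
  have hsurj : Function.Surjective fun p : K => p.1.1 := by
    have hcl : IsClosed (Prod.fst '' K) := (hKc.image continuous_fst).isClosed
    have hsub : U ⊆ Prod.fst '' K := fun t ht => ⟨(t, g t), subset_closure ⟨t, ht, rfl⟩, rfl⟩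
    intro t
    obtain ⟨p, hp, rfl⟩ := hcl.closure_subset_iff.2 hsub (hd t)
    exact ⟨⟨p, hp⟩, rfl⟩
  obtain ⟨s, hs, hsπ⟩ := CompactT2.ExtremallyDisconnected.projective (A := Q) continuous_id hπ hsurj
  refine ⟨fun t => (s t).1.2, continuous_snd.comp (continuous_subtype_val.comp hs), fun t ht => ?_⟩
  have h1 : (s t).1.1 = t := congrFun hsπ t
  have hcont : ContinuousWithinAt (fun p : Q × EReal => (g p.1, p.2)) G (s t).1 := by
    apply ContinuousAt.continuousWithinAt
    have hgt : ContinuousAt g (s t).1.1 := by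
      rw [h1]; exact hg.continuousAt (hU.mem_nhds ht)
    exact (ContinuousAt.comp (f := Prod.fst) (x := (s t).1) hgt continuousAt_fst).prodMk
      continuousAt_snd
  have hmem : (g (s t).1.1, (s t).1.2) ∈ closure (diagonal EReal) :=
    hcont.mem_closure (s t).2 (by rintro _ ⟨r, -, rfl⟩; rfl)
  rw [isClosed_diagonal.closure_eq] at hmem
  have : g (s t).1.1 = (s t).1.2 := hmem
  rw [h1] at this
  exact this.symm

theorem exists_extension {U : Set Q} (hU : IsOpen U) (hd : Dense U) {g : Q → ℝ}
    (hg : ContinuousOn g U) : ∃ z : CInfty Q, ∀ t ∈ U, z t = (g t : EReal) := by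
  obtain ⟨f, hf, hfg⟩ := exists_continuous_extension hU hd
    (continuous_coe_real_ereal.comp_continuousOn hg)
  refine ⟨⟨f, hf, isNowhereDense_of_dense hf (hd.mono fun t ht => ?_)⟩, hfg⟩
  simp [hfg t ht]

theorem exists_add (x y : CInfty Q) : ∃ z : CInfty Q, ∀ t ∈ x.finSet ∩ y.finSet,
    z t = (((x t).toReal + (y t).toReal : ℝ) : EReal) :=
  exists_extension (x.isOpen_finSet.inter y.isOpen_finSet)
    (x.dense_finSet.inter_of_isOpen_left y.dense_finSet x.isOpen_finSet)
    ((x.continuousOn_toReal.mono inter_subset_left).add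
      (y.continuousOn_toReal.mono inter_subset_right))

theorem exists_mul (x y : CInfty Q) : ∃ z : CInfty Q, ∀ t ∈ x.finSet ∩ y.finSet,
    z t = (((x t).toReal * (y t).toReal : ℝ) : EReal) :=
  exists_extension (x.isOpen_finSet.inter y.isOpen_finSet)
    (x.dense_finSet.inter_of_isOpen_left y.dense_finSet x.isOpen_finSet)
    ((x.continuousOn_toReal.mono inter_subset_left).mul
      (y.continuousOn_toReal.mono inter_subset_right))

theorem exists_smul (c : ℝ) (x : CInfty Q) : ∃ z : CInfty Q, ∀ t ∈ x.finSet,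
    z t = ((c * (x t).toReal : ℝ) : EReal) :=
  exists_extension x.isOpen_finSet x.dense_finSet (continuousOn_const.mul x.continuousOn_toReal)

/-- The sum: the (unique) element of `C_∞(Q)` that is the pointwise sum wherever both summands
are finite. -/
instance : Add (CInfty Q) := ⟨fun x y => (exists_add x y).choose⟩

/-- The product: the (unique) element of `C_∞(Q)` that is the pointwise product wherever both
factors are finite. -/
instance : Mul (CInfty Q) := ⟨fun x y => (exists_mul x y).choose⟩

/-- The scalar multiple: the (unique) element of `C_∞(Q)` that is the pointwise multiple wherever
`x` is finite. -/
instance : SMul ℝ (CInfty Q) := ⟨fun c x => (exists_smul c x).choose⟩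

theorem add_apply (x y : CInfty Q) {t : Q} (hx : t ∈ x.finSet) (hy : t ∈ y.finSet) :
    (x + y) t = (((x t).toReal + (y t).toReal : ℝ) : EReal) :=
  (exists_add x y).choose_spec t ⟨hx, hy⟩

theorem mul_apply (x y : CInfty Q) {t : Q} (hx : t ∈ x.finSet) (hy : t ∈ y.finSet) :
    (x * y) t = (((x t).toReal * (y t).toReal : ℝ) : EReal) :=
  (exists_mul x y).choose_spec t ⟨hx, hy⟩

theorem smul_apply (c : ℝ) (x : CInfty Q) {t : Q} (hx : t ∈ x.finSet) :
    (c • x) t = ((c * (x t).toReal : ℝ) : EReal) :=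
  (exists_smul c x).choose_spec t hx

theorem toGerm_injective : Function.Injective (toGerm (Q := Q)) := by
  intro x y h
  have h' : ∀ᶠ t in residual Q, (x t).toReal = (y t).toReal := Germ.coe_eq.1 h
  have hd : Dense {t | x t = y t} := by
    apply dense_of_mem_residual
    filter_upwards [h', x.eventually_finSet, y.eventually_finSet] with t ht hx hy
    rw [← coe_toReal hx, ← coe_toReal hy, ht]
  have hc := (isClosed_eq x.continuous_toFun y.continuous_toFun).closure_eq
  exact ext fun t => hc.subset (hd t)

theorem toGerm_add (x y : CInfty Q) : toGerm (x + y) = toGerm x + toGerm y :=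
  Germ.coe_eq.2 <| by
    filter_upwards [x.eventually_finSet, y.eventually_finSet] with t hx hy
    rw [add_apply x y hx hy, EReal.toReal_coe]

theorem toGerm_mul (x y : CInfty Q) : toGerm (x * y) = toGerm x * toGerm y :=
  Germ.coe_eq.2 <| by
    filter_upwards [x.eventually_finSet, y.eventually_finSet] with t hx hy
    rw [mul_apply x y hx hy, EReal.toReal_coe]

theorem toGerm_smul (c : ℝ) (x : CInfty Q) : toGerm (c • x) = c • toGerm x :=
  Germ.coe_eq.2 <| by
    filter_upwards [x.eventually_finSet] with t hx
    rw [smul_apply c x hx, EReal.toReal_coe]; rfl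

theorem ofReal_add (f g : C(Q, ℝ)) : ofReal (f + g) = ofReal f + ofReal g :=
  toGerm_injective (by rw [toGerm_add]; rfl)

theorem ofReal_mul (f g : C(Q, ℝ)) : ofReal (f * g) = ofReal f * ofReal g :=
  toGerm_injective (by rw [toGerm_mul]; rfl)

theorem ofReal_smul (c : ℝ) (f : C(Q, ℝ)) : ofReal (c • f) = c • ofReal f :=
  toGerm_injective (by rw [toGerm_smul]; rfl)

instance : CommRing (CInfty Q) where
  add_assoc x y z := toGerm_injective (by simp only [toGerm_add, add_assoc])
  zero_add x := toGerm_injective (by simp only [toGerm_add, toGerm_zero, zero_add])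
  add_zero x := toGerm_injective (by simp only [toGerm_add, toGerm_zero, add_zero])
  add_comm x y := toGerm_injective (by simp only [toGerm_add, add_comm])
  nsmul := nsmulRec
  zsmul := zsmulRec
  left_distrib x y z := toGerm_injective (by simp only [toGerm_add, toGerm_mul, mul_add])
  right_distrib x y z := toGerm_injective (by simp only [toGerm_add, toGerm_mul, add_mul])
  zero_mul x := toGerm_injective (by simp only [toGerm_mul, toGerm_zero, zero_mul])
  mul_zero x := toGerm_injective (by simp only [toGerm_mul, toGerm_zero, mul_zero])
  mul_assoc x y z := toGerm_injective (by simp only [toGerm_mul, mul_assoc])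
  one_mul x := toGerm_injective (by simp only [toGerm_mul, toGerm_one, one_mul])
  mul_one x := toGerm_injective (by simp only [toGerm_mul, toGerm_one, mul_one])
  neg_add_cancel x := toGerm_injective (by
    simp only [toGerm_add, toGerm_neg, toGerm_zero, neg_add_cancel])
  mul_comm x y := toGerm_injective (by simp only [toGerm_mul, mul_comm])

instance : Module ℝ (CInfty Q) where
  one_smul x := toGerm_injective (by simp only [toGerm_smul, one_smul])
  mul_smul a b x := toGerm_injective (by simp only [toGerm_smul, mul_smul])
  smul_zero a := toGerm_injective (by simp only [toGerm_smul, toGerm_zero, smul_zero])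
  smul_add a x y := toGerm_injective (by simp only [toGerm_smul, toGerm_add, smul_add])
  add_smul a b x := toGerm_injective (by simp only [toGerm_smul, toGerm_add, add_smul])
  zero_smul x := toGerm_injective (by simp only [toGerm_smul, toGerm_zero, zero_smul])

end CInfty

/-! ### The algebra `L⁰(B)`, supports, solid spaces, derivations -/

/-- `L⁰(B) = C_∞(Q)` where `Q` is the Stone space of the complete Boolean algebra `B`. -/
abbrev LZero (B : Type u) [CompleteBooleanAlgebra B] : Type u := CInfty (StoneSpace B)

variable {B : Type u} [CompleteBooleanAlgebra B]

open Classical in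
/-- The idempotent of `L⁰(B)` corresponding to `e ∈ B`: the characteristic function of the clopen
set `Q(e)`. -/
def idem (e : B) : LZero B :=
  CInfty.ofReal ⟨(StoneSpace.basic e).indicator 1,
    continuous_one.indicator (by simp [(StoneSpace.isClopen_basic e).frontier_eq])⟩

/-- The support `s(x) = 1 - sup {e ∈ B : e x = 0}`. -/
def supp (x : LZero B) : B := (sSup {e : B | idem e * x = 0})ᶜ

/-- A solid space in `L⁰(B)`: a nonzero linear subspace `Y` with `y ∈ Y` whenever `x ∈ Y` and
`|y| ≤ |x|`. -/
structure IsSolidSpace (Y : Submodule ℝ (LZero B)) : Prop where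
  ne_bot : Y ≠ ⊥
  solid : ∀ x ∈ Y, ∀ y : LZero B, |y| ≤ |x| → y ∈ Y

/-- `N` is a monotone quasi-norm on the subspace `Y` of `L⁰(B)`. -/
structure IsMonotoneQuasiNorm (Y : Submodule ℝ (LZero B)) (N : Y → ℝ) : Prop where
  nonneg : ∀ x, 0 ≤ N x
  eq_zero_iff : ∀ x, N x = 0 ↔ x = 0
  smul : ∀ (α : ℝ) (x : Y), N (α • x) = |α| * N x
  add_le : ∃ C : ℝ, 1 ≤ C ∧ ∀ x y, N (x + y) ≤ C * (N x + N y)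
  monotone : ∀ x y : Y, |(y : LZero B)| ≤ |(x : LZero B)| → N y ≤ N x

/-- A linear map `δ : X → Y` from an ideal `X` of `C(Q)` to a subspace `Y` of `L⁰(B)` is a
derivation if `δ(xy) = δ(x) y + x δ(y)` in `L⁰(B)` for all `x, y ∈ X`. -/
def IsDerivationOn {X : Ideal C(StoneSpace B, ℝ)} {Y : Submodule ℝ (LZero B)}
    (δ : X →ₗ[ℝ] Y) : Prop :=
  ∀ x y : X, (δ ⟨(x : C(StoneSpace B, ℝ)) * y, X.mul_mem_left _ y.2⟩ : LZero B) =
    (δ x : LZero B) * CInfty.ofReal (y : C(StoneSpace B, ℝ)) +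
      CInfty.ofReal (x : C(StoneSpace B, ℝ)) * (δ y : LZero B)

/-- `δ` is band preserving if `s(δ(x)) ≤ s(x)` for all `x ∈ X`. -/
def IsBandPreserving {X : Ideal C(StoneSpace B, ℝ)} {Y : Submodule ℝ (LZero B)}
    (δ : X →ₗ[ℝ] Y) : Prop :=
  ∀ x : X, supp (δ x : LZero B) ≤ supp (CInfty.ofReal (x : C(StoneSpace B, ℝ)))

end

/-!
Every continuous function on an extremally disconnected compact space is uniformly close to a
locally constant one, and a derivation `D : C(Q) → C_∞(Q)` is local, so it annihilates locally
constant functions. Hence every multiple `c • D f` is already of the form `D y` with `‖y‖ ≤ 1`.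
If `D f ≠ 0`, then `{D f ≠ 0}` has no isolated point and so contains infinitely many disjoint
nonempty clopen sets `K k`. Bounded functions can be pasted along disjoint open sets, so there is a
single `v` with `D v = c k • D f` on every `K k`. For `c k = k / N (χ_{K k} D f)` this gives
`k ≤ N (D v)` for all `k`, a contradiction. A derivation `δ` of an ideal `X` is reduced to this case
through `f ↦ δ (χ_K f)`, where `χ_K ∈ X`.
-/

section Idempotent

variable {R A M : Type*} [CommSemiring R] [AddCommGroup M]

theorem eq_zero_of_eq_idempotent_smul_add_smul [Semiring A] [Module A M] {p : A}
    (hp : IsIdempotentElem p) {m : M} (hm : m = p • m + p • m) : m = 0 := by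
  have hpm : p • m = p • m + p • m := by
    simpa only [smul_add, smul_smul, hp.eq] using congrArg (p • ·) hm
  rw [hm, left_eq_add.1 hpm, add_zero]

variable [CommSemiring A] [Algebra R A] [Module A M] [Module R M]

theorem derivation_idempotent_mul (D : Derivation R A M) {p : A} (hp : IsIdempotentElem p) (f : A) :
    D (p * f) = p • D f := by
  have hDp : D p = 0 :=
    eq_zero_of_eq_idempotent_smul_add_smul hp (by rw [← D.leibniz, hp.eq])
  rw [D.leibniz, hDp, smul_zero, add_zero]

/-- The Leibniz rule for a linear map defined on an ideal `X` of `A` only; the product of `x` and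
`y` in `X` is written `(x : A) • y`, so that it is again an element of `X`. -/
def IsIdealDerivation {X : Ideal A} (δ : X →ₗ[R] M) : Prop :=
  ∀ x y : X, δ ((x : A) • y) = (x : A) • δ y + (y : A) • δ x

namespace IsIdealDerivation

variable {X : Ideal A} {δ : X →ₗ[R] M}

theorem map_idempotent (hδ : IsIdealDerivation δ) {p : X} (hp : IsIdempotentElem (p : A)) :
    δ p = 0 := by
  have hpp : (p : A) • p = p := Subtype.ext hp
  exact eq_zero_of_eq_idempotent_smul_add_smul hp (by rw [← hδ, hpp])

theorem map_smul_idempotent (hδ : IsIdealDerivation δ) {p : X} (hp : IsIdempotentElem (p : A))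
    (x : X) : δ ((x : A) • p) = (p : A) • δ x := by
  rw [hδ, hδ.map_idempotent hp, smul_zero, zero_add]

/-- The derivation `f ↦ δ (f p)` of the whole algebra obtained by cutting `δ` down to an
idempotent `p` of the ideal. -/
def restrictIdempotent (hδ : IsIdealDerivation δ) {p : X} (hp : IsIdempotentElem (p : A)) :
    Derivation R A M :=
  .mk' (δ ∘ₗ (LinearMap.toSpanSingleton A X p).restrictScalars R) fun f g => by
    have hmul : (f * g) • p = ((f • p : X) : A) • (g • p) := Subtype.ext <| by
      simp only [Submodule.coe_smul, smul_eq_mul]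
      rw [mul_mul_mul_comm, hp.eq]
    have habsorb (h : A) : (p : A) • δ (h • p) = δ (h • p) := by
      rw [← hδ.map_smul_idempotent hp]
      exact congrArg δ (Subtype.ext (by simp [mul_assoc, hp.eq]))
    change δ ((f * g) • p) = f • δ (g • p) + g • δ (f • p)
    rw [hmul, hδ]
    simp only [Submodule.coe_smul, smul_eq_mul, mul_smul, habsorb]

theorem restrictIdempotent_apply (hδ : IsIdealDerivation δ) {p : X}
    (hp : IsIdempotentElem (p : A)) (x : X) :
    hδ.restrictIdempotent hp (x : A) = (p : A) • δ x :=
  hδ.map_smul_idempotent hp x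

theorem restrictIdempotent_mem_of_forall_mem (hδ : IsIdealDerivation δ) {p : X}
    (hp : IsIdempotentElem (p : A)) {Y : Submodule R M} (hY : ∀ x, δ x ∈ Y) (f : A) :
    hδ.restrictIdempotent hp f ∈ Y :=
  hY _

end IsIdealDerivation

end Idempotent

section ClopenChar

variable {Q : Type*} [TopologicalSpace Q] {K : Set Q}

/-- The characteristic function of a clopen set, as an element of the algebra `C(Q)`. -/
noncomputable def clopenChar (hK : IsClopen K) : C(Q, ℝ) := LocallyConstant.charFn ℝ hK

theorem clopenChar_of_mem (hK : IsClopen K) {t : Q} (ht : t ∈ K) : clopenChar hK t = 1 :=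
  indicator_of_mem ht _

theorem clopenChar_of_notMem (hK : IsClopen K) {t : Q} (ht : t ∉ K) : clopenChar hK t = 0 :=
  indicator_of_notMem ht _

theorem clopenChar_mul_congr (hK : IsClopen K) {f g : C(Q, ℝ)} (h : EqOn f g K) :
    clopenChar hK * f = clopenChar hK * g := by
  ext t
  by_cases ht : t ∈ K
  · simp [h ht]
  · simp [clopenChar_of_notMem hK ht]

theorem isIdempotentElem_clopenChar (hK : IsClopen K) : IsIdempotentElem (clopenChar hK) := by
  have h := clopenChar_mul_congr hK (g := 1) fun t ht => clopenChar_of_mem hK ht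
  rwa [mul_one] at h

theorem clopenChar_mem_ideal (hK : IsClopen K) {X : Ideal C(Q, ℝ)} {x : C(Q, ℝ)} (hx : x ∈ X)
    (hxK : ∀ t ∈ K, x t ≠ 0) : clopenChar hK ∈ X := by
  have hdenom_ne (t : Q) : clopenChar hK t * x t + (1 - clopenChar hK t) ≠ 0 := by
    by_cases ht : t ∈ K
    · simpa [clopenChar_of_mem hK ht] using hxK t ht
    · simp [clopenChar_of_notMem hK ht]
  let inverse : C(Q, ℝ) :=
    ⟨fun t => (clopenChar hK t * x t + (1 - clopenChar hK t))⁻¹,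
      Continuous.inv₀ (by fun_prop) hdenom_ne⟩
  have hone : EqOn (inverse * x) 1 K := fun t ht => by
    simp [inverse, clopenChar_of_mem hK ht, hxK t ht]
  rw [← mul_one (clopenChar hK), ← clopenChar_mul_congr hK hone, ← mul_assoc]
  exact X.mul_mem_left _ hx

end ClopenChar

section ZeroDimensional

variable {Q : Type*} [TopologicalSpace Q] [CompactSpace Q] [T2Space Q] [TotallyDisconnectedSpace Q]

theorem exists_locallyConstant_norm_sub_lt (f : C(Q, ℝ)) {ε : ℝ} (hε : 0 < ε) :
    ∃ s : LocallyConstant Q ℝ, ‖f - s‖ < ε := by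
  obtain ⟨⟨_, s, rfl⟩, hs⟩ :=
    ContinuousMap.exists_mem_subalgebra_near_continuousMap_of_separatesPoints _
      (LocallyConstant.separatesPoints_range_toContinuousMapAlgHom ℝ) f ε hε
  exact ⟨s, by rwa [norm_sub_rev]⟩

theorem exists_seq_isClopen_pairwise_disjoint_subset {U : Set Q} (hU : IsOpen U)
    (hinf : U.Infinite) :
    ∃ K : ℕ → Set Q, (∀ k, IsClopen (K k)) ∧ (∀ k, (K k).Nonempty) ∧
      Pairwise (Function.onFun Disjoint K) ∧ ∀ k, K k ⊆ U := by
  have : Infinite U := hinf.to_subtype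
  obtain ⟨V, hVinf, hVopen, hVdisj⟩ := exists_seq_infinite_isOpen_pairwise_disjoint U
  have hclopen (k : ℕ) : ∃ K : Set Q, IsClopen K ∧ K.Nonempty ∧ K ⊆ Subtype.val '' V k := by
    obtain ⟨t, ht⟩ := (hVinf k).nonempty
    obtain ⟨K, hK, htK, hKV⟩ := compact_exists_isClopen_in_isOpen
      (hU.isOpenMap_subtype_val _ (hVopen k)) (mem_image_of_mem Subtype.val ht)
    exact ⟨K, hK, ⟨t, htK⟩, hKV⟩
  choose K hK hne hKV using hclopen
  refine ⟨K, hK, hne, fun i j hij => ?_, fun k => (hKV k).trans (Subtype.coe_image_subset U _)⟩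
  exact ((disjoint_image_iff Subtype.val_injective).2 (hVdisj hij)).mono (hKV i) (hKV j)

end ZeroDimensional

namespace CInfty

variable {Q : Type*} [TopologicalSpace Q]

theorem zero_apply (t : Q) : (0 : CInfty Q) t = 0 := rfl

theorem isOpen_ne_zero (x : CInfty Q) : IsOpen {t | x t ≠ 0} :=
  isOpen_ne_fun x.continuous_toFun continuous_const

theorem nonempty_ne_zero {x : CInfty Q} (hx : x ≠ 0) : {t | x t ≠ 0}.Nonempty := by
  by_contra h
  exact hx (ext fun t => by_contra fun ht => h ⟨t, ht⟩)

variable [CompactSpace Q] [T2Space Q] [ExtremallyDisconnected Q]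

theorem abs_apply (x : CInfty Q) (t : Q) : |x| t = x t ⊔ -x t := rfl

/-- The embedding of `C(Q)` into `C_∞(Q)` as a ring homomorphism, which makes `C_∞(Q)` an algebra
over `C(Q)`. -/
noncomputable def ofRealHom : C(Q, ℝ) →+* CInfty Q where
  toFun := ofReal
  map_one' := rfl
  map_mul' := ofReal_mul
  map_zero' := rfl
  map_add' := ofReal_add

noncomputable instance : Algebra C(Q, ℝ) (CInfty Q) := ofRealHom.toAlgebra

theorem continuousMap_smul_def (f : C(Q, ℝ)) (x : CInfty Q) : f • x = ofReal f * x := rfl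

instance : SMulCommClass ℝ C(Q, ℝ) (CInfty Q) where
  smul_comm c f x := toGerm_injective <| by
    simp only [continuousMap_smul_def, toGerm_smul, toGerm_mul]
    exact Germ.coe_eq.2 (.of_forall fun t => (mul_smul_comm c (f t) _).symm)

theorem continuousMap_smul_apply_congr {U : Set Q} (hU : IsOpen U) {f g : C(Q, ℝ)}
    (h : EqOn f g U) (x : CInfty Q) {t : Q} (ht : t ∈ U) : (f • x) t = (g • x) t := by
  have hfin : EqOn (f • x).toFun (g • x).toFun (U ∩ x.finSet) := fun s ⟨hsU, hsx⟩ => by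
    have hreal (k : C(Q, ℝ)) : s ∈ (ofReal k).finSet := by simp [finSet]
    simp only [continuousMap_smul_def, mul_apply _ _ (hreal _) hsx, ofReal_apply, h hsU]
  exact hfin.of_subset_closure (continuous_toFun _).continuousOn (continuous_toFun _).continuousOn
    inter_subset_left (x.dense_finSet.open_subset_closure_inter hU) ht

variable {K : Set Q}

theorem clopenChar_smul_of_mem (hK : IsClopen K) (x : CInfty Q) {t : Q} (ht : t ∈ K) :
    (clopenChar hK • x) t = x t := by
  have h : EqOn (clopenChar hK) (1 : C(Q, ℝ)) K := fun s hs => clopenChar_of_mem hK hs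
  rw [continuousMap_smul_apply_congr hK.isOpen h x ht, one_smul]

theorem clopenChar_smul_of_notMem (hK : IsClopen K) (x : CInfty Q) {t : Q} (ht : t ∉ K) :
    (clopenChar hK • x) t = 0 := by
  have h : EqOn (clopenChar hK) (0 : C(Q, ℝ)) Kᶜ := fun s hs => clopenChar_of_notMem hK hs
  rw [continuousMap_smul_apply_congr hK.compl.isOpen h x ht, zero_smul, zero_apply]

theorem clopenChar_smul_congr (hK : IsClopen K) {x y : CInfty Q} (h : ∀ t ∈ K, x t = y t) :
    clopenChar hK • x = clopenChar hK • y := by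
  ext t
  by_cases ht : t ∈ K
  · simp only [clopenChar_smul_of_mem hK _ ht, h t ht]
  · simp only [clopenChar_smul_of_notMem hK _ ht]

theorem clopenChar_smul_eq_zero_iff (hK : IsClopen K) {x : CInfty Q} :
    clopenChar hK • x = 0 ↔ ∀ t ∈ K, x t = 0 := by
  refine ⟨fun h t ht => ?_, fun h => ?_⟩
  · rw [← clopenChar_smul_of_mem hK x ht, h, zero_apply]
  · rw [clopenChar_smul_congr hK (y := 0) h, smul_zero]

theorem abs_clopenChar_smul_le (hK : IsClopen K) (x : CInfty Q) : |clopenChar hK • x| ≤ |x| := by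
  intro t
  rw [abs_apply, abs_apply]
  by_cases ht : t ∈ K
  · rw [clopenChar_smul_of_mem hK x ht]
  · rw [clopenChar_smul_of_notMem hK x ht]
    rcases le_total 0 (x t) with h | h
    · simpa using Or.inl h
    · simpa using Or.inr h

end CInfty

section Pasting

variable {Q : Type*} [TopologicalSpace Q] [CompactSpace Q] [T2Space Q] [ExtremallyDisconnected Q]

theorem exists_cInfty_eqOn_of_isOpen {U : Set Q} (hU : IsOpen U) {g : Q → ℝ}
    (hg : ContinuousOn g U) : ∃ z : CInfty Q, ∀ t ∈ U, z t = g t := by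
  classical
  have hdense : Dense (U ∪ (closure U)ᶜ) := fun t => by
    by_cases ht : t ∈ closure U
    · exact closure_mono subset_union_left ht
    · exact subset_closure (Or.inr ht)
  have hcont : ContinuousOn (U.indicator g) (U ∪ (closure U)ᶜ) := by
    refine ContinuousOn.union_of_isOpen (hg.congr eqOn_indicator) ?_ hU
      isClosed_closure.isOpen_compl
    refine (continuousOn_const (c := (0 : ℝ))).congr fun t ht => ?_
    exact indicator_of_notMem (fun h => ht (subset_closure h)) g
  obtain ⟨z, hz⟩ :=
    CInfty.exists_extension (hU.union isClosed_closure.isOpen_compl) hdense hcont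
  exact ⟨z, fun t ht => by rw [hz t (Or.inl ht), indicator_of_mem ht]⟩

theorem exists_continuousMap_eqOn_of_isOpen {U : Set Q} (hU : IsOpen U) {g : Q → ℝ} {C : ℝ}
    (hg : ContinuousOn g U) (hC : ∀ t ∈ U, |g t| ≤ C) : ∃ f : C(Q, ℝ), EqOn f g U := by
  obtain ⟨z, hz⟩ := exists_cInfty_eqOn_of_isOpen hU hg
  let clip : Q → EReal := fun t => max (-C : ℝ) (min (C : ℝ) (z t))
  have hclip : Continuous clip := continuous_const.max (continuous_const.min z.continuous_toFun)
  have hfinite : MapsTo clip univ {⊥, ⊤}ᶜ := fun t _ => by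
    simp [clip]
  refine ⟨⟨fun t => (clip t).toReal, ?_⟩, fun t ht => ?_⟩
  · exact continuousOn_univ.1 (EReal.continuousOn_toReal.comp hclip.continuousOn hfinite)
  · obtain ⟨hlower, hupper⟩ := abs_le.1 (hC t ht)
    have hclip_eq : clip t = g t := by
      simp only [clip, hz t ht]
      rw [min_eq_right (EReal.coe_le_coe_iff.2 hupper),
        max_eq_right (EReal.coe_le_coe_iff.2 hlower)]
    simp [hclip_eq]

theorem exists_continuousMap_paste {ι : Type*} {U : ι → Set Q} (hU : ∀ i, IsOpen (U i))
    (hdisj : Pairwise (Function.onFun Disjoint U)) {y : ι → C(Q, ℝ)} {C : ℝ}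
    (hy : ∀ i, ‖y i‖ ≤ C) : ∃ v : C(Q, ℝ), ∀ i, EqOn v (y i) (U i) := by
  let g : Q → ℝ := fun t => ∑ᶠ i, (U i).indicator (y i) t
  have hg (i : ι) : EqOn g (y i) (U i) := fun t ht => by
    have hother (j : ι) (hji : j ≠ i) : (U j).indicator (y j) t = 0 :=
      indicator_of_notMem (disjoint_right.1 (hdisj hji) ht) _
    exact (finsum_eq_single _ i hother).trans (indicator_of_mem ht _)
  have hcont : ContinuousOn g (⋃ i, U i) :=
    .iUnion_of_isOpen (fun i => (y i).continuous.continuousOn.congr (hg i)) hU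
  have hbound : ∀ t ∈ ⋃ i, U i, |g t| ≤ C := fun t ht => by
    obtain ⟨i, hi⟩ := mem_iUnion.1 ht
    rw [hg i hi]
    exact ((y i).norm_coe_le_norm t).trans (hy i)
  obtain ⟨v, hv⟩ := exists_continuousMap_eqOn_of_isOpen (isOpen_iUnion hU) hcont hbound
  exact ⟨v, fun i => (hv.mono (subset_iUnion U i)).trans (hg i)⟩

end Pasting

section Derivation

variable {Q : Type*} [TopologicalSpace Q] [CompactSpace Q] [T2Space Q] [ExtremallyDisconnected Q]
  (D : Derivation ℝ C(Q, ℝ) (CInfty Q))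

theorem derivation_apply_congr {f g : C(Q, ℝ)} {t : Q} (h : f =ᶠ[𝓝 t] g) : D f t = D g t := by
  obtain ⟨U, hUfg, hU, htU⟩ := mem_nhds_iff.1 h
  obtain ⟨K, hK, htK, hKU⟩ := compact_exists_isClopen_in_isOpen hU htU
  have hKfg : EqOn f g K := fun s hs => hUfg (hKU hs)
  have hp := isIdempotentElem_clopenChar hK
  rw [← CInfty.clopenChar_smul_of_mem hK (D f) htK, ← derivation_idempotent_mul D hp,
    clopenChar_mul_congr hK hKfg, derivation_idempotent_mul D hp,
    CInfty.clopenChar_smul_of_mem hK (D g) htK]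

theorem derivation_apply_eq_zero_of_eventually_eq_const {f : C(Q, ℝ)} {t : Q} {c : ℝ}
    (h : ∀ᶠ s in 𝓝 t, f s = c) : D f t = 0 := by
  rw [derivation_apply_congr D (g := algebraMap ℝ C(Q, ℝ) c) h, D.map_algebraMap,
    CInfty.zero_apply]

theorem derivation_locallyConstant_eq_zero (s : LocallyConstant Q ℝ) : D (s : C(Q, ℝ)) = 0 :=
  CInfty.ext fun t =>
    derivation_apply_eq_zero_of_eventually_eq_const D (s.isLocallyConstant.eventually_eq t)

theorem infinite_derivation_ne_zero {f : C(Q, ℝ)} (hf : D f ≠ 0) : {t | D f t ≠ 0}.Infinite := by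
  obtain ⟨t, ht⟩ := CInfty.nonempty_ne_zero hf
  have hnotIsolated : ¬IsOpen {t} := fun hopen =>
    ht <| derivation_apply_eq_zero_of_eventually_eq_const D (c := f t) <|
      mem_of_superset (hopen.mem_nhds rfl) fun _ hs => congrArg f hs
  have : (𝓝[≠] t).NeBot := ⟨fun h => hnotIsolated ((isOpen_singleton_iff_punctured_nhds t).2 h)⟩
  exact infinite_of_mem_nhds t ((D f).isOpen_ne_zero.mem_nhds ht)

theorem exists_norm_le_one_derivation_eq_smul (f : C(Q, ℝ)) (c : ℝ) :
    ∃ y : C(Q, ℝ), ‖y‖ ≤ 1 ∧ D y = c • D f := by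
  obtain ⟨s, hs⟩ := exists_locallyConstant_norm_sub_lt (c • f) one_pos
  have hD : D (c • f - s) = c • D f := by
    rw [map_sub, D.map_smul, derivation_locallyConstant_eq_zero, sub_zero]
  exact ⟨c • f - s, hs.le, hD⟩

theorem exists_derivation_apply_eq_smul_on {ι : Type*} {U : ι → Set Q} (hU : ∀ i, IsOpen (U i))
    (hdisj : Pairwise (Function.onFun Disjoint U)) (f : C(Q, ℝ)) (c : ι → ℝ) :
    ∃ v : C(Q, ℝ), ∀ i, ∀ t ∈ U i, D v t = (c i • D f) t := by
  choose y hy hDy using fun i => exists_norm_le_one_derivation_eq_smul D f (c i)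
  obtain ⟨v, hv⟩ := exists_continuousMap_paste hU hdisj hy
  refine ⟨v, fun i t ht => ?_⟩
  rw [derivation_apply_congr D ((hv i).eventuallyEq_of_mem ((hU i).mem_nhds ht)), hDy]

end Derivation

section Gauge

variable {Q : Type*} [TopologicalSpace Q] [CompactSpace Q] [T2Space Q] [ExtremallyDisconnected Q]

/-- `N` is positive away from `0`, positively homogeneous, and does not increase when an element of
`Y` is multiplied by the characteristic function of a clopen set, under which `Y` is stable.
A monotone quasi-norm on a solid space has these properties. -/
structure IsClopenMonotoneGauge (Y : Submodule ℝ (CInfty Q)) (N : Y → ℝ) : Prop where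
  pos : ∀ y ≠ 0, 0 < N y
  smul : ∀ c : ℝ, 0 ≤ c → ∀ y, N (c • y) = c * N y
  clopenChar_smul_mem : ∀ {K : Set Q} (hK : IsClopen K) (y : Y), clopenChar hK • (y : CInfty Q) ∈ Y
  clopenChar_smul_le : ∀ {K : Set Q} (hK : IsClopen K) (y : Y),
    N ⟨clopenChar hK • (y : CInfty Q), clopenChar_smul_mem hK y⟩ ≤ N y

theorem IsClopenMonotoneGauge.derivation_eq_zero {Y : Submodule ℝ (CInfty Q)} {N : Y → ℝ}
    (hN : IsClopenMonotoneGauge Y N) {D : Derivation ℝ C(Q, ℝ) (CInfty Q)}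
    (hDY : ∀ f, D f ∈ Y) : D = 0 := by
  ext1 f
  by_contra hf
  obtain ⟨K, hK, hKne, hdisj, hKf⟩ := exists_seq_isClopen_pairwise_disjoint_subset
    (D f).isOpen_ne_zero (infinite_derivation_ne_zero D hf)
  let piece (k : ℕ) : Y := ⟨clopenChar (hK k) • D f, hN.clopenChar_smul_mem (hK k) ⟨D f, hDY f⟩⟩
  have hpiece (k : ℕ) : 0 < N (piece k) := hN.pos _ fun h => by
    obtain ⟨t, ht⟩ := hKne k
    exact hKf k ht
      ((CInfty.clopenChar_smul_eq_zero_iff (hK k)).1 (congrArg Subtype.val h) t ht)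
  obtain ⟨v, hv⟩ := exists_derivation_apply_eq_smul_on D (fun k => (hK k).isOpen) hdisj f
    fun k => k / N (piece k)
  have hbound (k : ℕ) : (k : ℝ) ≤ N ⟨D v, hDY v⟩ := by
    have hcut : (⟨clopenChar (hK k) • D v, hN.clopenChar_smul_mem (hK k) ⟨D v, hDY v⟩⟩ : Y) =
        ((k : ℝ) / N (piece k)) • piece k :=
      Subtype.ext ((CInfty.clopenChar_smul_congr (hK k) (hv k)).trans (smul_comm _ _ _).symm)
    calc (k : ℝ) = k / N (piece k) * N (piece k) := (div_mul_cancel₀ _ (hpiece k).ne').symm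
      _ = N ((k / N (piece k) : ℝ) • piece k) :=
        (hN.smul _ (div_nonneg k.cast_nonneg (hpiece k).le) _).symm
      _ ≤ N ⟨D v, hDY v⟩ := hcut ▸ hN.clopenChar_smul_le (hK k) ⟨D v, hDY v⟩
  obtain ⟨k, hk⟩ := exists_nat_gt (N ⟨D v, hDY v⟩)
  exact (hbound k).not_gt hk

theorem mainTheorem2_general (X : Ideal C(Q, ℝ)) (Y : Submodule ℝ (CInfty Q)) (N : Y → ℝ)
    (hN : IsClopenMonotoneGauge Y N) (δ : X →ₗ[ℝ] Y) (hδ : IsIdealDerivation (Y.subtype ∘ₗ δ))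
    (hband : ∀ x, {t | (δ x : CInfty Q) t ≠ 0} ⊆ closure {t | ∃ y ∈ X, y t ≠ 0}) : δ = 0 := by
  ext1 x
  by_contra hx
  obtain ⟨s, hs⟩ := CInfty.nonempty_ne_zero fun h => hx (Subtype.ext h)
  obtain ⟨t, htx, y, hyX, hty⟩ := mem_closure_iff.1 (hband x hs) _ (CInfty.isOpen_ne_zero _) hs
  obtain ⟨K, hK, htK, hKy⟩ := compact_exists_isClopen_in_isOpen
    (isOpen_ne_fun y.continuous continuous_const) hty
  let p : X := ⟨clopenChar hK, clopenChar_mem_ideal hK hyX hKy⟩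
  have hp : IsIdempotentElem (p : C(Q, ℝ)) := isIdempotentElem_clopenChar hK
  have hrestrict : hδ.restrictIdempotent hp = 0 :=
    hN.derivation_eq_zero (hδ.restrictIdempotent_mem_of_forall_mem hp fun x => (δ x).2)
  have hpx : clopenChar hK • (δ x : CInfty Q) = 0 := by
    simpa [hrestrict] using (hδ.restrictIdempotent_apply hp x).symm
  exact htx ((CInfty.clopenChar_smul_eq_zero_iff hK).1 hpx t htK)

end Gauge

section LZero

variable {B : Type*} [CompleteBooleanAlgebra B]

theorem idem_mul_eq_zero_iff {e : B} {x : LZero B} :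
    idem e * x = 0 ↔ ∀ t ∈ StoneSpace.basic e, x t = 0 :=
  CInfty.clopenChar_smul_eq_zero_iff (StoneSpace.isClopen_basic e)

theorem StoneSpace.basic_sSup (S : Set B) : basic (sSup S) = closure (⋃ e ∈ S, basic e) := by
  refine Subset.antisymm (fun t ht => mem_closure_iff.2 fun U hU htU => ?_) <|
    closure_minimal (iUnion₂_subset fun e he t => t.val_mono (le_sSup he))
      (isClopen_basic _).isClosed
  obtain ⟨c, htc, hcU⟩ := exists_basic_subset hU htU
  by_contra hempty
  have hdisj : c ⊓ sSup S = ⊥ := by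
    rw [inf_sSup_eq]
    refine iSup₂_eq_bot.2 fun e he => by_contra fun hne => ?_
    obtain ⟨s, hs⟩ := exists_mem_basic hne
    simp only [mem_basic, val_inf, Bool.and_eq_true] at hs
    exact hempty ⟨s, hcU hs.1, mem_iUnion₂.2 ⟨e, he, hs.2⟩⟩
  have hval := t.val_inf c (sSup S)
  simp [hdisj, mem_basic.1 htc, mem_basic.1 ht] at hval

theorem basic_supp (x : LZero B) : StoneSpace.basic (supp x) = closure {t | x t ≠ 0} := by
  have hnull : ⋃ e ∈ {e : B | idem e * x = 0}, StoneSpace.basic e = interior {t | x t = 0} := by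
    refine Subset.antisymm (iUnion₂_subset fun e he => ?_) fun t ht => ?_
    · exact interior_maximal (idem_mul_eq_zero_iff.1 he) (StoneSpace.isClopen_basic e).isOpen
    · obtain ⟨e, hte, he⟩ := StoneSpace.exists_basic_subset isOpen_interior ht
      have hnull_e : StoneSpace.basic e ⊆ {s | x s = 0} := he.trans interior_subset
      exact mem_iUnion₂.2 ⟨e, idem_mul_eq_zero_iff.2 hnull_e, hte⟩
  have hclosure_open : IsOpen (closure {t | x t ≠ 0}) :=
    ExtremallyDisconnected.open_closure _ x.isOpen_ne_zero
  have hcompl : StoneSpace.basic (supp x) =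
      (StoneSpace.basic (sSup {e : B | idem e * x = 0}))ᶜ := by
    ext t
    simp [supp]
  rw [hcompl, StoneSpace.basic_sSup, hnull, ← interior_compl, ← closure_compl]
  exact hclosure_open.interior_eq

theorem IsBandPreserving.ne_zero_subset_closure {X : Ideal C(StoneSpace B, ℝ)}
    {Y : Submodule ℝ (LZero B)} {δ : X →ₗ[ℝ] Y} (hδ : IsBandPreserving δ) (x : X) :
    {t | (δ x : LZero B) t ≠ 0} ⊆ closure {t | ∃ y ∈ X, y t ≠ 0} :=
  calc {t | (δ x : LZero B) t ≠ 0}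
      ⊆ StoneSpace.basic (supp (δ x : LZero B)) := basic_supp (δ x : LZero B) ▸ subset_closure
    _ ⊆ StoneSpace.basic (supp (CInfty.ofReal (x : C(StoneSpace B, ℝ)))) :=
      fun t => t.val_mono (hδ x)
    _ ⊆ closure {t | ∃ y ∈ X, y t ≠ 0} := by
      rw [basic_supp]
      exact closure_mono fun t ht => ⟨x, x.2, by simpa using ht⟩

theorem IsDerivationOn.isIdealDerivation {X : Ideal C(StoneSpace B, ℝ)}
    {Y : Submodule ℝ (LZero B)} {δ : X →ₗ[ℝ] Y} (hδ : IsDerivationOn δ) :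
    IsIdealDerivation (Y.subtype ∘ₗ δ) := fun x y =>
  calc (δ ((x : C(StoneSpace B, ℝ)) • y) : LZero B)
      = (δ x : LZero B) * CInfty.ofReal (y : C(StoneSpace B, ℝ)) +
          CInfty.ofReal (x : C(StoneSpace B, ℝ)) * (δ y : LZero B) := hδ x y
    _ = CInfty.ofReal (x : C(StoneSpace B, ℝ)) * (δ y : LZero B) +
          CInfty.ofReal (y : C(StoneSpace B, ℝ)) * (δ x : LZero B) := by ring

theorem IsMonotoneQuasiNorm.isClopenMonotoneGauge {Y : Submodule ℝ (LZero B)} {N : Y → ℝ}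
    (hN : IsMonotoneQuasiNorm Y N) (hY : IsSolidSpace Y) : IsClopenMonotoneGauge Y N where
  pos y hy := (hN.nonneg y).lt_of_ne' (mt (hN.eq_zero_iff y).1 hy)
  smul c hc y := by rw [hN.smul, abs_of_nonneg hc]
  clopenChar_smul_mem hK y := hY.solid y y.2 _ (CInfty.abs_clopenChar_smul_le hK _)
  clopenChar_smul_le hK y := hN.monotone y _ (CInfty.abs_clopenChar_smul_le hK _)

end LZero

theorem mainTheorem2 {B : Type*} [CompleteBooleanAlgebra B]
    (X : Ideal C(StoneSpace B, ℝ)) (Y : Submodule ℝ (LZero B)) (hY : IsSolidSpace Y)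
    (N : Y → ℝ) (hN : IsMonotoneQuasiNorm Y N)
    (δ : X →ₗ[ℝ] Y) (hδ : IsDerivationOn δ) (hband : IsBandPreserving δ) :
    δ = 0 :=
  mainTheorem2_general X Y N (hN.isClopenMonotoneGauge hY) δ hδ.isIdealDerivation
    hband.ne_zero_subset_closure
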